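/- Let $K,m\ge 1$. A $(K,m)$-uplifting bandit consists of a baseline probability distribution $P_0$ on $\mathbb R^m$, probability distributions $P_1,\dots,P_K$ on $\mathbb R^m$ (one per action), and sets $V_1,\dots,V_K\subseteq\{1,\dots,m\}$ of affected variables such that $P_a$ and $P_0$ have the same marginal on the coordinates outside $V_a$. It is 1-sub-Gaussian if for every $a\in\{0,\dots,K\}$, $i\in\{1,\dots,m\}$ and $\lambda\in\mathbb R$, with $y\sim P_a$ and $\mu_{a,i}=\mathbb E[y_i]$, one has $\mathbb E[\exp(\lambda (y_i-\mu_{a,i}))]\le \exp(\lambda^2/2)$. Put $r_a=\sum_{i=1}^m\mu_{a,i}$, $r_\star=\max_{1\le a\le K}r_a$ and $\Delta_a=r_\star-r_a$. In each round $t$ a learner chooses (possibly at random) an action $a_t\in\{1,\dots,K\}$, based on the previously chosen actions and observed payoff vectors and on prior knowledge of $P_0$ and $(V_a)_{1\le a\le K}$ only, and then observes a payoff vector $y_t\in\mathbb R^m$ which, given the past and $a_t$, has distribution $P_{a_t}$. The regret is $\mathrm{Reg}_T=r_\star T-\sum_{t=1}^T r_{a_t}$. An algorithm is consistent if $\mathbb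 E[\mathrm{Reg}_T]=o(T^p)$ for every $p>0$ on every 1-sub-Gaussian $(K,m)$-uplifting bandit. **Proposition.** Let $\pi$ be a consistent algorithm of this kind. Then for all sequences $(L_a)_{1\le a\le K}$ in $\{1,\dots,m\}$ and $(\Delta_a)_{1\le a\le K}$ in $[0,\infty)$ with $\Delta_1=0$, there is a 1-sub-Gaussian $(K,m)$-uplifting bandit whose suboptimality gaps are $(\Delta_a)$ and whose affected sets satisfy $|V_a|=L_a$ for all $a$, each variable in $V_a$ being genuinely affected ($\mu_{a,i}\ne\mu_{0,i}$ for $i\in V_a$), on which $\pi$ has $$\liminf_{T\to\infty}\frac{\mathbb E[\mathrm{Reg}_T]}{\log T}\ \ge\ \sum_{a:\,\Delta_a>0}\frac{2L_a^2}{\Delta_a}.$$ -/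

import Mathlib

open MeasureTheory ProbabilityTheory Filter Asymptotics Finset

/-- A `(K, m)`-uplifting bandit: a baseline distribution and one distribution per action, all on
`ℝ^m`, and for each action a set of affected variables such that the action distribution and the
baseline distribution have the same (joint) marginal on the unaffected variables. -/
structure UpliftingBandit (K m : ℕ) where
  /-- the baseline distribution -/
  base : Measure (Fin m → ℝ)
  /-- the payoff distribution of each action -/
  dist : Fin K → Measure (Fin m → ℝ)
  /-- the set of variables affected by each action -/
  affected : Fin K → Finset (Fin m)
  isProb_base : IsProbabilityMeasure base
  isProb_dist : ∀ a, IsProbabilityMeasure (dist a)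
  marginal_eq : ∀ a,
    (dist a).map (fun (y : Fin m → ℝ) (i : {i : Fin m // i ∉ affected a}) => y i) =
      base.map (fun (y : Fin m → ℝ) (i : {i : Fin m // i ∉ affected a}) => y i)

/-- A probability distribution on `ℝ^m` each of whose coordinates, once centered, is
1-sub-Gaussian: `E[exp (t (y i - E[y i]))] ≤ exp (t ^ 2 / 2)` for all real `t` (the exponential
moments being finite). -/
def HasOneSubGaussianNoise {m : ℕ} (P : Measure (Fin m → ℝ)) : Prop :=
  ∀ i : Fin m, HasSubgaussianMGF (fun y : Fin m → ℝ => y i - ∫ z, z i ∂P) 1 P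

namespace UpliftingBandit

variable {K m : ℕ}

attribute [instance] isProb_base isProb_dist

/-- All the noise variables, of the baseline and of the actions, are 1-sub-Gaussian. -/
def IsOneSubGaussian (B : UpliftingBandit K m) : Prop :=
  HasOneSubGaussianNoise B.base ∧ ∀ a, HasOneSubGaussianNoise (B.dist a)

/-- Expected payoff of variable `i` under the baseline. -/
noncomputable def baseMean (B : UpliftingBandit K m) (i : Fin m) : ℝ := ∫ y, y i ∂B.base

/-- Expected payoff of variable `i` under action `a`. -/
noncomputable def mean (B : UpliftingBandit K m) (a : Fin K) (i : Fin m) : ℝ := ∫ y, y i ∂B.dist a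

/-- Expected reward of action `a`; the reward is the sum of all the payoffs. -/
noncomputable def reward (B : UpliftingBandit K m) (a : Fin K) : ℝ := ∑ i, B.mean a i

/-- Largest expected reward of an action. -/
noncomputable def optReward (B : UpliftingBandit K m) : ℝ := ⨆ a, B.reward a

/-- Suboptimality gap of action `a`. -/
noncomputable def gap (B : UpliftingBandit K m) (a : Fin K) : ℝ := B.optReward - B.reward a

/-- The instance has suboptimality gaps `Δ` and numbers of affected variables `L`. -/
def HasParameters (B : UpliftingBandit K m) (Δ : Fin K → ℝ) (L : Fin K → ℕ) : Prop :=
  ∀ a, B.gap a = Δ a ∧ (B.affected a).card = L a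

/-- The payoff distributions of the actions, as a Markov kernel. -/
noncomputable def payoffKernel (B : UpliftingBandit K m) : Kernel (Fin K) (Fin m → ℝ) :=
  Kernel.ofFunOfCountable B.dist

instance (B : UpliftingBandit K m) : IsMarkovKernel B.payoffKernel :=
  ⟨fun a => B.isProb_dist a⟩

end UpliftingBandit

/-- What the learner sees in one round: the chosen action and the whole payoff vector. -/
abbrev Round (K m : ℕ) : Type := Fin K × (Fin m → ℝ)

/-- A (possibly randomized) policy: the law of the first action, and for each `n` the law of the
action of round `n + 1` given the actions and payoffs of rounds `0, …, n`. -/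
structure Policy (K m : ℕ) where
  first : Measure (Fin K)
  next : (n : ℕ) → Kernel ((_ : Finset.Iic n) → Round K m) (Fin K)
  isProb_first : IsProbabilityMeasure first
  isMarkov_next : ∀ n, IsMarkovKernel (next n)

attribute [instance] Policy.isProb_first Policy.isMarkov_next

/-- An algorithm that may use, as prior knowledge about the instance, the baseline distribution and
the sets of affected variables: to each value of this knowledge it assigns a policy. -/
abbrev InformedAlgorithm (K m : ℕ) : Type :=
  Measure (Fin m → ℝ) → (Fin K → Finset (Fin m)) → Policy K m

namespace UpliftingBandit

variable {K m : ℕ}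

/-- Law of the next round given the history: the policy draws the action, then the payoff vector is
drawn from the distribution of that action, independently of the past given the action. -/
noncomputable def stepKernel (B : UpliftingBandit K m) (π : Policy K m) (n : ℕ) :
    Kernel ((_ : Finset.Iic n) → Round K m) (Round K m) :=
  π.next n ⊗ₖ B.payoffKernel.prodMkLeft ((_ : Finset.Iic n) → Round K m)

instance (B : UpliftingBandit K m) (π : Policy K m) (n : ℕ) : IsMarkovKernel (B.stepKernel π n) := by
  unfold stepKernel; infer_instance

/-- Law of the whole interaction (rounds indexed by `0, 1, 2, …`) of a policy with an instance. -/
noncomputable def interaction (B : UpliftingBandit K m) (π : Policy K m) :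
    Measure (ℕ → Round K m) :=
  Kernel.trajMeasure (X := fun _ => Round K m) (π.first ⊗ₘ B.payoffKernel) (B.stepKernel π)

/-- Regret of the first `T` rounds along a trajectory. -/
noncomputable def regret (B : UpliftingBandit K m) (T : ℕ) (ω : ℕ → Round K m) : ℝ :=
  B.optReward * T - ∑ t ∈ Finset.range T, B.reward (ω t).1

/-- Expected regret after `T` rounds of an algorithm which is given the baseline distribution and
the affected sets of the instance. -/
noncomputable def expectedRegret (B : UpliftingBandit K m) (alg : InformedAlgorithm K m) (T : ℕ) :
    ℝ :=
  ∫ ω, B.regret T ω ∂B.interaction (alg B.base B.affected)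

end UpliftingBandit

/-- Consistency over the class of all 1-sub-Gaussian `(K, m)`-uplifting bandits: on each of them the
expected regret is `o(T ^ p)` for every `p > 0`. -/
def InformedAlgorithm.IsConsistent {K m : ℕ} (alg : InformedAlgorithm K m) : Prop :=
  ∀ B : UpliftingBandit K m, B.IsOneSubGaussian → ∀ p : ℝ, 0 < p →
    (fun T : ℕ => B.expectedRegret alg T) =o[atTop] (fun T : ℕ => (T : ℝ) ^ p)

/-!
The lower bound is of Lai–Robbins type; what is specific to uplifting bandits is the instance on
which it is attained. In the instance `UpliftingBandit.gaussian V c`, the variables affected by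
action `a` all carry the *same* standard Gaussian noise, shifted by `c a`, and the unaffected ones
carry another noise, independent of it. Raising the reward of `a` by `D` then only requires shifting
one Gaussian by `D / L`, where `L` is the number of variables affected by `a`. This costs a
Kullback–Leibler divergence of `(D / L) ^ 2 / 2`, and it changes neither the baseline nor the
affected sets, so that the prior knowledge of the learner does not reveal it.

Let `a` have gap `Δ > 0` and raise its reward by `Δ + p`, which makes `a` the only optimal action of
the new instance. By consistency, the expected number of rounds in which `a` is *not* chosen is
`T - o(T)` on the original instance and eventually at most `T ^ p` on the new one. The two laws of
the first `T` rounds are related by the product of the likelihood ratios of the rounds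
(`lintegral_trajMeasure_of_withDensity`), whose logarithm has, on the original instance, the
expectation `-(D / L) ^ 2 / 2 * E[N_a]` with `D = Δ + p` and `N_a` the number of choices of `a`
(`UpliftingBandit.integral_roundLLR`). The Donsker–Varadhan inequality for `s * Z`, where `Z` is the
fraction of rounds in which `a` is not chosen (`UpliftingBandit.information_inequality`), taken at
`s = (1 - p) * log T`, gives
`E[N_a] ≥ (1 - p - o(1)) * 2 * L ^ 2 / (Δ + p) ^ 2 * log T`. Letting `p → 0` and summing the
contributions `Δ * E[N_a]` to the regret over the suboptimal actions gives the theorem.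
-/

/-! ### Change of measure for trajectories -/

section Trajectories

variable {E : Type*} [MeasurableSpace E]

/-- The first step of a trajectory has the initial law. -/
theorem trajMeasure_map_zero (μ₀ : Measure E) [IsProbabilityMeasure μ₀]
    (κ : (n : ℕ) → Kernel ((_ : Finset.Iic n) → E) E) [∀ n, IsMarkovKernel (κ n)] :
    (Kernel.trajMeasure (X := fun _ => E) μ₀ κ).map (fun ω => ω 0) = μ₀ := by
  have h : (fun ω : ℕ → E => ω 0) =
      (MeasurableEquiv.piUnique (fun _ : Finset.Iic 0 => E)) ∘
        (Preorder.frestrictLe (π := fun _ => E) 0) := by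
    ext ω; rfl
  rw [h, ← Measure.map_map (by fun_prop) (by fun_prop), Kernel.trajMeasure,
    Measure.map_comp _ _ (by fun_prop), Kernel.traj_map_frestrictLe, Kernel.partialTraj_self,
    Measure.id_comp, Measure.map_map (by fun_prop) (by fun_prop)]
  exact (congrArg (fun φ => μ₀.map φ) (MeasurableEquiv.self_comp_symm _)).trans Measure.map_id

/-- One-step disintegration of the integral of a function of the first `n + 2` coordinates, written
as a function of the past and of the next step. -/
theorem lintegral_trajMeasure_succ (μ₀ : Measure E) [IsProbabilityMeasure μ₀]
    (κ : (n : ℕ) → Kernel ((_ : Finset.Iic n) → E) E) [∀ n, IsMarkovKernel (κ n)] (n : ℕ)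
    {G : ((_ : Finset.Iic n) → E) × E → ENNReal} (hG : Measurable G) :
    ∫⁻ ω, G (Preorder.frestrictLe n ω, ω (n + 1)) ∂Kernel.trajMeasure (X := fun _ => E) μ₀ κ =
      ∫⁻ ω, ∫⁻ r, G (Preorder.frestrictLe n ω, r) ∂κ n (Preorder.frestrictLe n ω)
        ∂Kernel.trajMeasure (X := fun _ => E) μ₀ κ := by
  have h := Kernel.map_frestrictLe_trajMeasure_compProd_eq_map_trajMeasure
    (X := fun _ => E) (μ₀ := μ₀) (κ := κ) (a := n)
  have h2 := congrArg (fun μ => ∫⁻ x, G x ∂μ) h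
  rw [lintegral_map hG (by fun_prop), Measure.lintegral_compProd hG,
    lintegral_map (hG.lintegral_kernel_prod_right') (by fun_prop)] at h2
  exact h2.symm

/-- Change of measure for trajectories: if the initial law and all the transition kernels of a
second process have density `g` with respect to those of a first one, then on events of the first
`n + 1` steps the density of the second process is the product of the densities of the steps. -/
theorem lintegral_trajMeasure_of_withDensity (μ₀ μ₀' : Measure E) [IsProbabilityMeasure μ₀]
    [IsProbabilityMeasure μ₀'] (κ κ' : (n : ℕ) → Kernel ((_ : Finset.Iic n) → E) E)
    [∀ n, IsMarkovKernel (κ n)] [∀ n, IsMarkovKernel (κ' n)] {g : E → ENNReal} (hg : Measurable g)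
    (h₀ : μ₀' = μ₀.withDensity g) (hκ : ∀ n h, κ' n h = (κ n h).withDensity g) (n : ℕ)
    {f : (ℕ → E) → ENNReal} (hf : Measurable f) (hdep : DependsOn f (Set.Iic n)) :
    ∫⁻ ω, f ω ∂Kernel.trajMeasure (X := fun _ => E) μ₀' κ' =
      ∫⁻ ω, f ω * ∏ t ∈ range (n + 1), g (ω t) ∂Kernel.trajMeasure (X := fun _ => E) μ₀ κ := by
  induction n generalizing f with
  | zero =>
    have hfac : ∀ ω : ℕ → E, f ω = f (fun _ => ω 0) := fun ω => hdep fun i hi => by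
      obtain rfl : i = 0 := by simpa using hi
      rfl
    have hf0 : Measurable fun r : E => f (fun _ => r) := by fun_prop
    calc ∫⁻ ω, f ω ∂Kernel.trajMeasure (X := fun _ => E) μ₀' κ'
        = ∫⁻ ω, f (fun _ => ω 0) ∂Kernel.trajMeasure (X := fun _ => E) μ₀' κ' :=
          lintegral_congr hfac
      _ = ∫⁻ r, f (fun _ => r) ∂μ₀' := by
          conv_rhs => rw [← trajMeasure_map_zero μ₀' κ']
          rw [lintegral_map hf0 (by fun_prop)]
      _ = ∫⁻ r, f (fun _ => r) * g r ∂μ₀ := by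
          rw [h₀, lintegral_withDensity_eq_lintegral_mul _ hg hf0]
          simp [mul_comm]
      _ = ∫⁻ ω, f (fun _ => ω 0) * g (ω 0) ∂Kernel.trajMeasure (X := fun _ => E) μ₀ κ := by
          conv_lhs => rw [← trajMeasure_map_zero μ₀ κ]
          rw [lintegral_map (by fun_prop) (by fun_prop)]
      _ = _ := by
          refine lintegral_congr fun ω => ?_
          rw [← hfac]; simp
  | succ n ih =>
    -- a history of `n + 1` steps followed by one more step, extended to a trajectory
    let e : ((_ : Finset.Iic n) → E) × E → (ℕ → E) := fun p =>
      Function.update (fun k => p.1 ⟨min k n, by simp⟩) (n + 1) p.2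
    have he : Measurable e := by
      refine measurable_pi_lambda _ fun k => ?_
      by_cases hk : k = n + 1
      · subst hk; simpa [e] using measurable_snd
      · simp only [e, Function.update_of_ne hk]; fun_prop
    have hext : ∀ (ω : ℕ → E) (i : ℕ), i ≤ n + 1 →
        e (Preorder.frestrictLe n ω, ω (n + 1)) i = ω i := by
      intro ω i hi
      rcases hi.lt_or_eq with h | rfl
      · have : i ≤ n := by omega
        simp [e, Function.update_of_ne h.ne, this]
      · simp [e]
    have hfac : ∀ ω : ℕ → E, f ω = f (e (Preorder.frestrictLe n ω, ω (n + 1))) := fun ω =>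
      hdep fun i hi => (hext ω i hi).symm
    have hG : Measurable fun p => f (e p) := hf.comp he
    have hφ : Measurable fun h : (_ : Finset.Iic n) → E => ∫⁻ r, f (e (h, r)) * g r ∂κ n h :=
      (Measurable.lintegral_kernel_prod_right' (κ := κ n)
        (f := fun p => f (e p) * g p.2) (hG.mul (by fun_prop)))
    have hφ' : Measurable fun ω : ℕ → E => ∫⁻ r, f (e (Preorder.frestrictLe n ω, r)) * g r
        ∂κ n (Preorder.frestrictLe n ω) := hφ.comp (by fun_prop)
    have hdφ : DependsOn (fun ω : ℕ → E => ∫⁻ r, f (e (Preorder.frestrictLe n ω, r)) * g r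
        ∂κ n (Preorder.frestrictLe n ω)) (Set.Iic n) := by
      intro ω ω' h
      have : Preorder.frestrictLe (π := fun _ => E) n ω = Preorder.frestrictLe n ω' := by
        ext i; exact h i (Finset.mem_Iic.1 i.2)
      simp only [this]
    let p : ((_ : Finset.Iic n) → E) → ENNReal := fun h =>
      ∏ t ∈ range (n + 1), g (h ⟨min t n, by simp⟩)
    have hp : Measurable p := by
      refine Finset.measurable_prod _ fun t _ => ?_
      fun_prop
    have hpω : ∀ ω : ℕ → E, p (Preorder.frestrictLe n ω) = ∏ t ∈ range (n + 1), g (ω t) := by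
      intro ω
      refine Finset.prod_congr rfl fun t ht => ?_
      have : t ≤ n := by simpa [Nat.lt_succ_iff] using ht
      simp [this]
    calc ∫⁻ ω, f ω ∂Kernel.trajMeasure (X := fun _ => E) μ₀' κ'
        = ∫⁻ ω, f (e (Preorder.frestrictLe n ω, ω (n + 1)))
            ∂Kernel.trajMeasure (X := fun _ => E) μ₀' κ' := lintegral_congr hfac
      _ = ∫⁻ ω, ∫⁻ r, f (e (Preorder.frestrictLe n ω, r)) ∂κ' n (Preorder.frestrictLe n ω)
            ∂Kernel.trajMeasure (X := fun _ => E) μ₀' κ' := lintegral_trajMeasure_succ μ₀' κ' n hG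
      _ = ∫⁻ ω, ∫⁻ r, f (e (Preorder.frestrictLe n ω, r)) * g r ∂κ n (Preorder.frestrictLe n ω)
            ∂Kernel.trajMeasure (X := fun _ => E) μ₀' κ' := by
          refine lintegral_congr fun ω => ?_
          have hGω : Measurable fun r => f (e (Preorder.frestrictLe n ω, r)) :=
            hG.comp measurable_prodMk_left
          rw [hκ, lintegral_withDensity_eq_lintegral_mul _ hg hGω]
          simp [mul_comm]
      _ = ∫⁻ ω, (∫⁻ r, f (e (Preorder.frestrictLe n ω, r)) * g r ∂κ n (Preorder.frestrictLe n ω))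
            * ∏ t ∈ range (n + 1), g (ω t) ∂Kernel.trajMeasure (X := fun _ => E) μ₀ κ :=
          ih hφ' hdφ
      _ = ∫⁻ ω, ∫⁻ r, f (e (Preorder.frestrictLe n ω, r)) * g r * p (Preorder.frestrictLe n ω)
            ∂κ n (Preorder.frestrictLe n ω) ∂Kernel.trajMeasure (X := fun _ => E) μ₀ κ := by
          refine lintegral_congr fun ω => ?_
          have hGω : Measurable fun r => f (e (Preorder.frestrictLe n ω, r)) * g r :=
            (hG.comp measurable_prodMk_left).mul hg
          rw [lintegral_mul_const _ hGω, hpω]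
      _ = ∫⁻ ω, f (e (Preorder.frestrictLe n ω, ω (n + 1))) * g (ω (n + 1))
            * p (Preorder.frestrictLe n ω) ∂Kernel.trajMeasure (X := fun _ => E) μ₀ κ :=
          (lintegral_trajMeasure_succ μ₀ κ n
            (G := fun q => f (e q) * g q.2 * p q.1)
            ((hG.mul (by fun_prop)).mul (by fun_prop))).symm
      _ = _ := by
          refine lintegral_congr fun ω => ?_
          rw [← hfac, hpω, Finset.prod_range_succ _ (n + 1)]
          ring

end Trajectories

/-! ### The Donsker–Varadhan inequality -/

section Divergence

variable {Ω : Type*} [MeasurableSpace Ω]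

/-- The Donsker–Varadhan inequality for a bounded function `f`, where `Q` has density `exp Λ` with
respect to `P` as far as `exp f` is concerned: `-∫ Λ ∂P` plays the role of the divergence. -/
theorem exp_integral_add_integral_le {P Q : Measure Ω} [IsProbabilityMeasure P]
    [IsProbabilityMeasure Q] {f Λ : Ω → ℝ} (hf : Measurable f) {C : ℝ} (hfC : ∀ ω, |f ω| ≤ C)
    (hΛm : Measurable Λ) (hΛ : Integrable Λ P)
    (h : ∫⁻ ω, ENNReal.ofReal (Real.exp (f ω)) ∂Q =
      ∫⁻ ω, ENNReal.ofReal (Real.exp (f ω + Λ ω)) ∂P) :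
    Real.exp (∫ ω, f ω ∂P + ∫ ω, Λ ω ∂P) ≤ ∫ ω, Real.exp (f ω) ∂Q := by
  have hfP : Integrable f P := Integrable.of_bound hf.aestronglyMeasurable C (ae_of_all _ hfC)
  have hQ : Integrable (fun ω => Real.exp (f ω)) Q := by
    refine Integrable.of_bound (by fun_prop) (Real.exp C) (ae_of_all _ fun ω => ?_)
    rw [Real.norm_eq_abs, Real.abs_exp]
    exact Real.exp_le_exp.2 ((le_abs_self _).trans (hfC ω))
  have hP : Integrable (fun ω => Real.exp (f ω + Λ ω)) P := by
    refine ⟨by fun_prop, ?_⟩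
    rw [hasFiniteIntegral_iff_ofReal (ae_of_all _ fun _ => (Real.exp_pos _).le), ← h,
      ← hasFiniteIntegral_iff_ofReal (ae_of_all _ fun _ => (Real.exp_pos _).le)]
    exact hQ.2
  have heq : ∫ ω, Real.exp (f ω) ∂Q = ∫ ω, Real.exp (f ω + Λ ω) ∂P := by
    rw [integral_eq_lintegral_of_nonneg_ae (ae_of_all _ fun _ => (Real.exp_pos _).le) (by fun_prop),
      integral_eq_lintegral_of_nonneg_ae (ae_of_all _ fun _ => (Real.exp_pos _).le) (by fun_prop),
      h]
  rw [heq, ← integral_add hfP hΛ]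
  exact convexOn_exp.map_integral_le Real.continuous_exp.continuousOn isClosed_univ
    (ae_of_all _ fun _ => Set.mem_univ _) (hfP.add hΛ) hP

/-- The Donsker–Varadhan inequality for `f = s * Z` with `Z` valued in `[0, 1]`. -/
theorem exp_mul_integral_add_integral_le {P Q : Measure Ω} [IsProbabilityMeasure P]
    [IsProbabilityMeasure Q] {Z Λ : Ω → ℝ} (hZ : Measurable Z) (hZ01 : ∀ ω, Z ω ∈ Set.Icc 0 1)
    (hΛm : Measurable Λ) (hΛ : Integrable Λ P) (s : ℝ)
    (h : ∫⁻ ω, ENNReal.ofReal (Real.exp (s * Z ω)) ∂Q =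
      ∫⁻ ω, ENNReal.ofReal (Real.exp (s * Z ω + Λ ω)) ∂P) :
    Real.exp (s * ∫ ω, Z ω ∂P + ∫ ω, Λ ω ∂P) ≤ 1 + Real.exp s * ∫ ω, Z ω ∂Q := by
  have hb : ∀ ω, |s * Z ω| ≤ |s| := fun ω => by
    rw [abs_mul, abs_of_nonneg (hZ01 ω).1]
    exact mul_le_of_le_one_right (abs_nonneg _) (hZ01 ω).2
  have hZQ : Integrable Z Q := Integrable.of_bound hZ.aestronglyMeasurable 1
    (ae_of_all _ fun ω => by rw [Real.norm_eq_abs, abs_of_nonneg (hZ01 ω).1]; exact (hZ01 ω).2)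
  have h1 := exp_integral_add_integral_le (hZ.const_mul s) hb hΛm hΛ h
  rw [integral_const_mul] at h1
  refine h1.trans ?_
  have h2 : ∫ ω, Real.exp (s * Z ω) ∂Q ≤ ∫ ω, (1 + Real.exp s * Z ω) ∂Q := by
    refine integral_mono_of_nonneg (ae_of_all _ fun _ => (Real.exp_pos _).le)
      ((integrable_const _).add (hZQ.const_mul _)) (ae_of_all _ fun ω => ?_)
    have hc := convexOn_exp.2 (Set.mem_univ 0) (Set.mem_univ s)
      (sub_nonneg.2 (hZ01 ω).2) (hZ01 ω).1 (by ring)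
    simp only [smul_eq_mul, mul_zero, zero_add, Real.exp_zero, mul_one] at hc
    simp only
    rw [mul_comm s]
    have := (hZ01 ω).1
    linarith
  refine h2.trans_eq ?_
  rw [integral_add (integrable_const _) (hZQ.const_mul _), integral_const_mul]
  simp

end Divergence

/-! ### Gaussian uplifting bandits -/

section Gaussian

variable {m : ℕ}

/-- The payoff vector whose entries in `V` are all equal to `p.1` and whose other entries are all
equal to `p.2`. -/
def blockVector (V : Finset (Fin m)) (p : ℝ × ℝ) (i : Fin m) : ℝ := if i ∈ V then p.1 else p.2

theorem measurable_blockVector (V : Finset (Fin m)) : Measurable (blockVector V) := by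
  refine measurable_pi_lambda _ fun i => ?_
  by_cases hi : i ∈ V <;> simp only [blockVector, hi, if_true, if_false] <;> fun_prop

/-- Law of a payoff vector which has the same standard Gaussian noise, shifted by `c`, in all the
entries of `V`, and an independent standard Gaussian noise, again the same one, in all the other
entries. -/
noncomputable def blockGaussian (V : Finset (Fin m)) (c : ℝ) : Measure (Fin m → ℝ) :=
  ((gaussianReal c 1).prod (gaussianReal 0 1)).map (blockVector V)

instance (V : Finset (Fin m)) (c : ℝ) : IsProbabilityMeasure (blockGaussian V c) :=
  Measure.isProbabilityMeasure_map (measurable_blockVector V).aemeasurable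

theorem blockGaussian_map_eval (V : Finset (Fin m)) (c : ℝ) (i : Fin m) :
    (blockGaussian V c).map (fun y => y i) = gaussianReal (if i ∈ V then c else 0) 1 := by
  rw [blockGaussian, Measure.map_map (measurable_pi_apply i) (measurable_blockVector V)]
  by_cases hi : i ∈ V
  · have : (fun y : Fin m → ℝ => y i) ∘ blockVector V = Prod.fst := by
      ext p; simp [blockVector, hi]
    rw [this]; simp [hi]
  · have : (fun y : Fin m → ℝ => y i) ∘ blockVector V = Prod.snd := by
      ext p; simp [blockVector, hi]
    rw [this]; simp [hi]

theorem integral_eval_of_map_eq_gaussianReal {P : Measure (Fin m → ℝ)} {i : Fin m} {c : ℝ}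
    (h : P.map (fun y => y i) = gaussianReal c 1) : ∫ y, y i ∂P = c := by
  have := integral_map (μ := P) (φ := fun y : Fin m → ℝ => y i) (f := fun x : ℝ => x)
    (measurable_pi_apply i).aemeasurable (by fun_prop)
  rw [h, integral_id_gaussianReal] at this
  exact this.symm

theorem hasSubgaussianMGF_id_gaussianReal : HasSubgaussianMGF id 1 (gaussianReal 0 1) where
  integrable_exp_mul t := by simpa using integrable_exp_mul_gaussianReal t
  mgf_le t := by rw [mgf_id_gaussianReal]; simp

theorem hasOneSubGaussianNoise_of_map_eq_gaussianReal {P : Measure (Fin m → ℝ)} (c : Fin m → ℝ)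
    (h : ∀ i, P.map (fun y => y i) = gaussianReal (c i) 1) : HasOneSubGaussianNoise P := by
  intro i
  rw [integral_eval_of_map_eq_gaussianReal (h i)]
  refine (HasSubgaussianMGF.id_map_iff ((measurable_pi_apply i).sub_const _).aemeasurable).1 ?_
  have : P.map (fun y => y i - c i) = gaussianReal 0 1 := by
    have h2 : (fun y : Fin m → ℝ => y i - c i) = (fun x : ℝ => x - c i) ∘ fun y => y i := rfl
    rw [h2, ← Measure.map_map (by fun_prop) (by fun_prop), h i, gaussianReal_map_sub_const,
      sub_self]
  rw [this]
  exact hasSubgaussianMGF_id_gaussianReal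

/-- Log-density of `gaussianReal c' 1` with respect to `gaussianReal c 1`. -/
noncomputable def gaussianLLR (c c' x : ℝ) : ℝ := (c' - c) * (x - c) - (c' - c) ^ 2 / 2

theorem measurable_gaussianLLR (c c' : ℝ) : Measurable (gaussianLLR c c') := by
  unfold gaussianLLR; fun_prop

theorem gaussianReal_eq_withDensity (c c' : ℝ) :
    gaussianReal c' 1 =
      (gaussianReal c 1).withDensity fun x => ENNReal.ofReal (Real.exp (gaussianLLR c c' x)) := by
  rw [gaussianReal_of_var_ne_zero c' one_ne_zero, gaussianReal_of_var_ne_zero c one_ne_zero,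
    ← withDensity_mul _ (measurable_gaussianPDF c 1)
      ((measurable_gaussianLLR c c').exp.ennreal_ofReal)]
  congr 1
  ext x
  simp only [Pi.mul_apply, gaussianPDF, gaussianPDFReal]
  rw [← ENNReal.ofReal_mul (by positivity), mul_assoc (√_)⁻¹, ← Real.exp_add]
  congr 3
  simp only [gaussianLLR, NNReal.coe_one]
  ring

theorem integrable_gaussianLLR (c c' : ℝ) : Integrable (gaussianLLR c c') (gaussianReal c 1) := by
  have h : Integrable (fun x : ℝ => x) (gaussianReal c 1) :=
    (memLp_id_gaussianReal (μ := c) (v := 1) 1).integrable le_rfl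
  exact ((h.sub (integrable_const _)).const_mul _).sub (integrable_const _)

theorem integral_gaussianLLR (c c' : ℝ) :
    ∫ x, gaussianLLR c c' x ∂gaussianReal c 1 = -((c' - c) ^ 2 / 2) := by
  have h : Integrable (fun x : ℝ => x) (gaussianReal c 1) :=
    (memLp_id_gaussianReal (μ := c) (v := 1) 1).integrable le_rfl
  unfold gaussianLLR
  have h2 : Integrable (fun x => (c' - c) * (x - c)) (gaussianReal c 1) :=
    (h.sub (integrable_const _)).const_mul _
  rw [integral_sub h2 (integrable_const _), integral_const_mul,
    integral_sub h (integrable_const _), integral_id_gaussianReal]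
  simp

theorem blockGaussian_eq_withDensity {V : Finset (Fin m)} {i : Fin m} (hi : i ∈ V) (c c' : ℝ) :
    blockGaussian V c' = (blockGaussian V c).withDensity
      fun y => ENNReal.ofReal (Real.exp (gaussianLLR c c' (y i))) := by
  have hg : Measurable fun x => ENNReal.ofReal (Real.exp (gaussianLLR c c' x)) :=
    (measurable_gaussianLLR c c').exp.ennreal_ofReal
  have hgi : Measurable fun y : Fin m → ℝ => ENNReal.ofReal (Real.exp (gaussianLLR c c' (y i))) :=
    hg.comp (measurable_pi_apply i)
  refine Measure.ext_of_lintegral _ fun f hf => ?_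
  rw [lintegral_withDensity_eq_lintegral_mul _ hgi hf]
  unfold blockGaussian
  rw [lintegral_map hf (measurable_blockVector V), lintegral_map (hgi.mul hf)
    (measurable_blockVector V), gaussianReal_eq_withDensity c c', prod_withDensity_left hg]
  refine (lintegral_withDensity_eq_lintegral_mul _ (hg.comp measurable_fst)
    (hf.comp (measurable_blockVector V))).trans ?_
  simp [blockVector, hi]

end Gaussian

namespace UpliftingBandit

variable {K m : ℕ}

/-- The uplifting bandit whose action `a` shifts the variables of `V a` from mean `0` to mean `c a`.
All the noises are standard Gaussian; under action `a` the affected variables share one noise, and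
the unaffected ones share another one, independent of it. Under the baseline all the variables share
the same noise. -/
noncomputable def gaussian (V : Fin K → Finset (Fin m)) (c : Fin K → ℝ) : UpliftingBandit K m where
  base := (gaussianReal 0 1).map fun x _ => x
  dist a := blockGaussian (V a) (c a)
  affected := V
  isProb_base := Measure.isProbabilityMeasure_map (by fun_prop)
  isProb_dist a := inferInstance
  marginal_eq a := by
    have h : (fun (y : Fin m → ℝ) (i : {i : Fin m // i ∉ V a}) => y i) ∘ blockVector (V a) =
        (fun (x : ℝ) (_ : {i : Fin m // i ∉ V a}) => x) ∘ Prod.snd := by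
      ext p i; simp [blockVector, i.2]
    rw [blockGaussian, Measure.map_map (by fun_prop) (measurable_blockVector _), h,
      ← Measure.map_map (by fun_prop) measurable_snd, Measure.map_snd_prod,
      Measure.map_map (by fun_prop) (by fun_prop), measure_univ, one_smul]
    rfl

variable (V : Fin K → Finset (Fin m)) (c : Fin K → ℝ)

theorem base_gaussian : (gaussian V c).base = (gaussianReal 0 1).map fun x _ => x := rfl

theorem affected_gaussian : (gaussian V c).affected = V := rfl

theorem gaussian_base_map_eval (i : Fin m) :
    (gaussian V c).base.map (fun y => y i) = gaussianReal 0 1 := by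
  rw [base_gaussian, Measure.map_map (by fun_prop) (by fun_prop)]
  exact Measure.map_id

theorem isOneSubGaussian_gaussian : (gaussian V c).IsOneSubGaussian :=
  ⟨hasOneSubGaussianNoise_of_map_eq_gaussianReal _ (gaussian_base_map_eval V c),
    fun a => hasOneSubGaussianNoise_of_map_eq_gaussianReal _ (blockGaussian_map_eval (V a) (c a))⟩

theorem baseMean_gaussian (i : Fin m) : (gaussian V c).baseMean i = 0 :=
  integral_eval_of_map_eq_gaussianReal (gaussian_base_map_eval V c i)

theorem mean_gaussian (a : Fin K) (i : Fin m) :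
    (gaussian V c).mean a i = if i ∈ V a then c a else 0 :=
  integral_eval_of_map_eq_gaussianReal (blockGaussian_map_eval (V a) (c a) i)

theorem reward_gaussian (a : Fin K) : (gaussian V c).reward a = (V a).card * c a := by
  simp [reward, mean_gaussian, Finset.sum_ite_mem]

end UpliftingBandit

/-! ### Regret and numbers of pulls -/

namespace UpliftingBandit

variable {K m : ℕ} (B : UpliftingBandit K m) (π : Policy K m)

instance : IsProbabilityMeasure (B.interaction π) := by
  unfold interaction; infer_instance

theorem reward_le_optReward (a : Fin K) : B.reward a ≤ B.optReward :=
  le_ciSup (Set.finite_range _).bddAbove a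

theorem gap_nonneg (a : Fin K) : 0 ≤ B.gap a := sub_nonneg.2 (B.reward_le_optReward a)

theorem optReward_eq_of_forall_le {a : Fin K} (h : ∀ b, B.reward b ≤ B.reward a) :
    B.optReward = B.reward a := by
  have : Nonempty (Fin K) := ⟨a⟩
  exact le_antisymm (ciSup_le h) (B.reward_le_optReward a)

theorem stepKernel_apply (n : ℕ) (h : (_ : Finset.Iic n) → Round K m) :
    B.stepKernel π n h = π.next n h ⊗ₘ B.payoffKernel := by
  refine Measure.ext_of_lintegral _ fun f hf => ?_
  rw [stepKernel, Kernel.lintegral_compProd _ _ _ hf, Measure.lintegral_compProd hf]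
  simp

/-- In every round, given the action, the payoff vector has the law attached to that action. -/
theorem exists_interaction_map_eval_eq_compProd (t : ℕ) :
    ∃ ν : Measure (Fin K), IsProbabilityMeasure ν ∧
      (B.interaction π).map (fun ω => ω t) = ν ⊗ₘ B.payoffKernel := by
  cases t with
  | zero => exact ⟨π.first, inferInstance, trajMeasure_map_zero _ _⟩
  | succ n =>
    let μ := (B.interaction π).map (Preorder.frestrictLe n)
    have : IsProbabilityMeasure μ := Measure.isProbabilityMeasure_map (by fun_prop)
    refine ⟨π.next n ∘ₘ μ, inferInstance, Measure.ext_of_lintegral _ fun f hf => ?_⟩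
    have h := lintegral_trajMeasure_succ (π.first ⊗ₘ B.payoffKernel) (B.stepKernel π) n
      (G := fun p => f p.2) (hf.comp measurable_snd)
    have hin : Measurable fun a => ∫⁻ y, f (a, y) ∂B.payoffKernel a :=
      hf.lintegral_kernel_prod_right'
    rw [lintegral_map hf (by fun_prop), Measure.lintegral_compProd hf,
      Measure.lintegral_bind (Kernel.aemeasurable _) hin.aemeasurable,
      lintegral_map hin.lintegral_kernel (by fun_prop)]
    refine h.trans (lintegral_congr fun ω => ?_)
    rw [stepKernel_apply, Measure.lintegral_compProd hf]

/-- Probability that the action of round `t` is `a`. -/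
noncomputable def pullProb (t : ℕ) (a : Fin K) : ℝ := (B.interaction π).real {ω | (ω t).1 = a}

/-- Expected number of times action `a` is chosen in the first `T` rounds. -/
noncomputable def expectedPulls (T : ℕ) (a : Fin K) : ℝ := ∑ t ∈ range T, B.pullProb π t a

theorem measurableSet_action_eq (t : ℕ) (a : Fin K) :
    MeasurableSet {ω : ℕ → Round K m | (ω t).1 = a} :=
  (measurable_fst.comp (measurable_pi_apply t)) (MeasurableSet.singleton a)

theorem integral_indicator_action (t : ℕ) (a : Fin K) :
    ∫ ω, (if (ω t).1 = a then 1 else 0 : ℝ) ∂B.interaction π = B.pullProb π t a := by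
  rw [pullProb, ← integral_indicator_one (measurableSet_action_eq t a)]
  simp [Set.indicator_apply]

theorem measurable_indicator_action (t : ℕ) (a : Fin K) :
    Measurable fun ω : ℕ → Round K m => (if (ω t).1 = a then 1 else 0 : ℝ) :=
  Measurable.ite (measurableSet_action_eq t a) measurable_const measurable_const

theorem integrable_indicator_action (t : ℕ) (a : Fin K) :
    Integrable (fun ω => (if (ω t).1 = a then 1 else 0 : ℝ)) (B.interaction π) :=
  Integrable.of_bound (measurable_indicator_action t a).aestronglyMeasurable 1
    (ae_of_all _ fun ω => by split_ifs <;> simp)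

theorem expectedPulls_nonneg (T : ℕ) (a : Fin K) : 0 ≤ B.expectedPulls π T a :=
  Finset.sum_nonneg fun _ _ => measureReal_nonneg

theorem sum_pullProb (t : ℕ) : ∑ a, B.pullProb π t a = 1 := by
  simp_rw [← integral_indicator_action]
  rw [← integral_finsetSum _ fun a _ => B.integrable_indicator_action π t a]
  simp

theorem sum_expectedPulls (T : ℕ) : ∑ a, B.expectedPulls π T a = T := by
  simp_rw [expectedPulls]
  rw [Finset.sum_comm]
  simp [sum_pullProb]

theorem integral_regret (T : ℕ) :
    ∫ ω, B.regret T ω ∂B.interaction π = ∑ a, B.gap a * B.expectedPulls π T a := by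
  have h : ∀ ω : ℕ → Round K m, B.regret T ω =
      ∑ a, B.gap a * ∑ t ∈ range T, (if (ω t).1 = a then 1 else 0 : ℝ) := by
    intro ω
    simp_rw [Finset.mul_sum]
    rw [Finset.sum_comm]
    simp [regret, gap, mul_comm]
  simp_rw [h]
  rw [integral_finsetSum _ fun a _ => (integrable_finsetSum _ fun t _ =>
    B.integrable_indicator_action π t a).const_mul _]
  refine Finset.sum_congr rfl fun a _ => ?_
  rw [integral_const_mul, integral_finsetSum _ fun t _ => B.integrable_indicator_action π t a]
  simp_rw [integral_indicator_action]
  rfl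

end UpliftingBandit

/-! ### Changing the mean of one action -/

namespace UpliftingBandit

variable {K m : ℕ} (c : Fin K → ℝ) (π : Policy K m)

/-- Log-likelihood ratio of one round when the common mean of the variables affected by action `a`
is changed from `x` to `x'`; the payoff is read off at the affected variable `i`. -/
noncomputable def roundLLR (a : Fin K) (i : Fin m) (x x' : ℝ) (r : Round K m) : ℝ :=
  if r.1 = a then gaussianLLR x x' (r.2 i) else 0

theorem measurable_roundLLR (a : Fin K) (i : Fin m) (x x' : ℝ) :
    Measurable (roundLLR (K := K) (m := m) a i x x') :=
  Measurable.ite (measurable_fst (MeasurableSet.singleton a))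
    ((measurable_gaussianLLR x x').comp (by fun_prop)) measurable_const

variable {V : Fin K → Finset (Fin m)}

theorem compProd_payoffKernel_update {a : Fin K} {i : Fin m} (hi : i ∈ V a) (x' : ℝ)
    (ν : Measure (Fin K)) [IsProbabilityMeasure ν] :
    ν ⊗ₘ (gaussian V (Function.update c a x')).payoffKernel =
      (ν ⊗ₘ (gaussian V c).payoffKernel).withDensity
        fun r => ENNReal.ofReal (Real.exp (roundLLR a i (c a) x' r)) := by
  have hg : Measurable fun r : Round K m => ENNReal.ofReal (Real.exp (roundLLR a i (c a) x' r)) :=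
    (measurable_roundLLR a i (c a) x').exp.ennreal_ofReal
  refine Measure.ext_of_lintegral _ fun f hf => ?_
  rw [lintegral_withDensity_eq_lintegral_mul _ hg hf, Measure.lintegral_compProd hf,
    Measure.lintegral_compProd (hg.mul hf)]
  refine lintegral_congr fun b => ?_
  change ∫⁻ y, f (b, y) ∂blockGaussian (V b) (Function.update c a x' b) =
    ∫⁻ y, _ ∂blockGaussian (V b) (c b)
  by_cases hb : b = a
  · subst hb
    have hgi : Measurable fun y : Fin m → ℝ =>
        ENNReal.ofReal (Real.exp (gaussianLLR (c b) x' (y i))) :=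
      ((measurable_gaussianLLR (c b) x').comp (measurable_pi_apply i)).exp.ennreal_ofReal
    have hfb : Measurable fun y => f (b, y) := hf.comp measurable_prodMk_left
    rw [Function.update_self, blockGaussian_eq_withDensity hi (c b) x',
      lintegral_withDensity_eq_lintegral_mul _ hgi hfb]
    simp [roundLLR]
  · simp [roundLLR, hb]

theorem integrable_roundLLR {a : Fin K} {i : Fin m} (hi : i ∈ V a) (x' : ℝ) (t : ℕ) :
    Integrable (fun ω => roundLLR a i (c a) x' (ω t)) ((gaussian V c).interaction π) := by
  obtain ⟨ν, hν, h⟩ := (gaussian V c).exists_interaction_map_eval_eq_compProd π t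
  have hm := measurable_roundLLR (K := K) (m := m) a i (c a) x'
  suffices H : Integrable (roundLLR (K := K) (m := m) a i (c a) x')
      (((gaussian V c).interaction π).map fun ω => ω t) from
    (integrable_map_measure hm.aestronglyMeasurable
      (measurable_pi_apply t).aemeasurable).1 H
  rw [h, Measure.integrable_compProd_iff hm.aestronglyMeasurable]
  refine ⟨ae_of_all _ fun b => ?_, Integrable.of_finite⟩
  by_cases hb : b = a
  · subst hb
    have : Integrable (gaussianLLR (c b) x') ((blockGaussian (V b) (c b)).map fun y => y i) := by
      rw [blockGaussian_map_eval]; simpa [hi] using integrable_gaussianLLR (c b) x'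
    simp only [roundLLR, if_true]
    exact (integrable_map_measure this.aestronglyMeasurable
      (measurable_pi_apply i).aemeasurable).1 this
  · simp [roundLLR, hb]

/-- Each round contributes to the divergence its probability of choosing `a`, times the divergence
of the two payoff distributions. -/
theorem integral_roundLLR {a : Fin K} {i : Fin m} (hi : i ∈ V a) (x' : ℝ) (t : ℕ) :
    ∫ ω, roundLLR a i (c a) x' (ω t) ∂(gaussian V c).interaction π =
      -((x' - c a) ^ 2 / 2) * (gaussian V c).pullProb π t a := by
  obtain ⟨ν, hν, h⟩ := (gaussian V c).exists_interaction_map_eval_eq_compProd π t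
  have hm := measurable_roundLLR (K := K) (m := m) a i (c a) x'
  have hint := (integrable_map_measure hm.aestronglyMeasurable
    (measurable_pi_apply t).aemeasurable).2 (integrable_roundLLR c π hi x' t)
  have hin : ∀ b, ∫ y, roundLLR a i (c a) x' (b, y) ∂(gaussian V c).payoffKernel b =
      if b = a then -((x' - c a) ^ 2 / 2) else 0 := by
    intro b
    by_cases hb : b = a
    · subst hb
      have h1 := integral_map (μ := blockGaussian (V b) (c b)) (φ := fun y : Fin m → ℝ => y i)
        (measurable_pi_apply i).aemeasurable
        (measurable_gaussianLLR (c b) x').aestronglyMeasurable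
      rw [blockGaussian_map_eval, if_pos hi, integral_gaussianLLR] at h1
      simp only [roundLLR, if_true]
      exact h1.symm
    · simp [roundLLR, hb]
  have hpull : (gaussian V c).pullProb π t a = ν.real {a} := by
    have h2 : (((gaussian V c).interaction π).map fun ω => ω t).map Prod.fst = ν := by
      rw [h]; exact Measure.fst_compProd _ _
    rw [← h2, Measure.map_map measurable_fst (measurable_pi_apply t),
      map_measureReal_apply (measurable_fst.comp (measurable_pi_apply t))
        (MeasurableSet.singleton a)]
    rfl
  rw [← integral_map (μ := (gaussian V c).interaction π) (φ := fun ω : ℕ → Round K m => ω t)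
    (measurable_pi_apply t).aemeasurable hm.aestronglyMeasurable]
  rw [h] at hint ⊢
  rw [Measure.integral_compProd hint]
  simp_rw [hin]
  rw [hpull, integral_fintype Integrable.of_finite]
  simp [mul_comm]

/-- The information inequality: to tell the two instances apart, which have different mean payoffs
of action `a`, a policy has to choose action `a` often enough. -/
theorem information_inequality {a : Fin K} {i : Fin m} (hi : i ∈ V a) (x' s : ℝ) {T : ℕ}
    (hT : 0 < T) :
    Real.exp (s * (1 - (gaussian V c).expectedPulls π T a / T) -
        (x' - c a) ^ 2 / 2 * (gaussian V c).expectedPulls π T a) ≤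
      1 + Real.exp s *
        (1 - (gaussian V (Function.update c a x')).expectedPulls π T a / T) := by
  obtain ⟨n, rfl⟩ : ∃ n, T = n + 1 := ⟨T - 1, by omega⟩
  set B := gaussian V c
  set B' := gaussian V (Function.update c a x')
  have hT' : (0 : ℝ) < (n + 1 : ℕ) := by positivity
  let N : (ℕ → Round K m) → ℝ := fun ω => ∑ t ∈ range (n + 1), if (ω t).1 = a then 1 else 0
  let Z : (ℕ → Round K m) → ℝ := fun ω => 1 - N ω / (n + 1 : ℕ)
  let Λ : (ℕ → Round K m) → ℝ := fun ω => ∑ t ∈ range (n + 1), roundLLR a i (c a) x' (ω t)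
  have hN : Measurable N := Finset.measurable_sum _ fun t _ => measurable_indicator_action t a
  have hZ : Measurable Z := (hN.div_const _).const_sub 1
  have hNi : ∀ A : UpliftingBandit K m, Integrable N (A.interaction π) := fun A =>
    integrable_finsetSum _ fun t _ => A.integrable_indicator_action π t a
  have hZint : ∀ A : UpliftingBandit K m,
      ∫ ω, Z ω ∂A.interaction π = 1 - A.expectedPulls π (n + 1) a / (n + 1 : ℕ) := by
    intro A
    have h1 : ∫ ω, N ω ∂A.interaction π = A.expectedPulls π (n + 1) a := by
      rw [integral_finsetSum _ fun t _ => A.integrable_indicator_action π t a]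
      simp_rw [integral_indicator_action]
      rfl
    rw [integral_sub (integrable_const _) ((hNi A).div_const _), integral_div, h1]
    simp
  have hN0 : ∀ ω, 0 ≤ N ω := fun ω => Finset.sum_nonneg fun t _ => by split_ifs <;> simp
  have hN1 : ∀ ω, N ω ≤ (n + 1 : ℕ) := fun ω => by
    refine (Finset.sum_le_sum (g := fun _ => (1 : ℝ)) fun t _ => ?_).trans_eq (by simp)
    split_ifs <;> simp
  have hZ01 : ∀ ω, Z ω ∈ Set.Icc 0 1 := fun ω =>
    ⟨sub_nonneg.2 ((div_le_one hT').2 (hN1 ω)), sub_le_self _ (div_nonneg (hN0 ω) hT'.le)⟩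
  have hm := measurable_roundLLR (K := K) (m := m) a i (c a) x'
  have hΛm : Measurable Λ := Finset.measurable_sum _ fun t _ => hm.comp (measurable_pi_apply t)
  have hΛ : Integrable Λ (B.interaction π) :=
    integrable_finsetSum _ fun t _ => integrable_roundLLR c π hi x' t
  have hΛint : ∫ ω, Λ ω ∂B.interaction π =
      -((x' - c a) ^ 2 / 2) * B.expectedPulls π (n + 1) a := by
    rw [integral_finsetSum _ fun t _ => integrable_roundLLR c π hi x' t, expectedPulls,
      Finset.mul_sum]
    exact Finset.sum_congr rfl fun t _ => integral_roundLLR c π hi x' t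
  have hdep : DependsOn (fun ω => ENNReal.ofReal (Real.exp (s * Z ω))) (Set.Iic n) := by
    intro ω ω' h
    have : N ω = N ω' := Finset.sum_congr rfl fun t ht => by
      rw [h t (Nat.lt_succ_iff.1 (Finset.mem_range.1 ht))]
    simp only [Z, this]
  have hchange : ∫⁻ ω, ENNReal.ofReal (Real.exp (s * Z ω)) ∂B'.interaction π =
      ∫⁻ ω, ENNReal.ofReal (Real.exp (s * Z ω + Λ ω)) ∂B.interaction π := by
    refine (lintegral_trajMeasure_of_withDensity (π.first ⊗ₘ B.payoffKernel)
      (π.first ⊗ₘ B'.payoffKernel) (B.stepKernel π) (B'.stepKernel π)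
      (g := fun r => ENNReal.ofReal (Real.exp (roundLLR a i (c a) x' r))) hm.exp.ennreal_ofReal
      (compProd_payoffKernel_update c hi x' _) (fun n h => ?_) n
      (hZ.const_mul s).exp.ennreal_ofReal hdep).trans (lintegral_congr fun ω => ?_)
    · rw [stepKernel_apply, stepKernel_apply, compProd_payoffKernel_update c hi x']
    · rw [← ENNReal.ofReal_prod_of_nonneg fun _ _ => (Real.exp_pos _).le, ← Real.exp_sum,
        ← ENNReal.ofReal_mul (Real.exp_pos _).le, ← Real.exp_add]
  have := exp_mul_integral_add_integral_le hZ hZ01 hΛm hΛ s hchange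
  rw [hZint, hZint, hΛint, neg_mul, ← sub_eq_add_neg] at this
  exact this

end UpliftingBandit

/-! ### Asymptotic lower bound -/

namespace UpliftingBandit

variable {K m : ℕ}

theorem gap_mul_expectedPulls_le_integral_regret (B : UpliftingBandit K m) (π : Policy K m) (T : ℕ)
    (a : Fin K) : B.gap a * B.expectedPulls π T a ≤ ∫ ω, B.regret T ω ∂B.interaction π := by
  rw [integral_regret]
  exact Finset.single_le_sum
    (f := fun b => B.gap b * B.expectedPulls π T b)
    (fun b _ => mul_nonneg (B.gap_nonneg b) (B.expectedPulls_nonneg π T b)) (Finset.mem_univ a)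

/-- If every action but `a` has gap at least `δ`, the regret controls the number of rounds in which
`a` is not chosen. -/
theorem mul_sub_expectedPulls_le_integral_regret (B : UpliftingBandit K m) (π : Policy K m)
    {a : Fin K} {δ : ℝ} (h : ∀ b, b ≠ a → δ ≤ B.gap b) (T : ℕ) :
    δ * (T - B.expectedPulls π T a) ≤ ∫ ω, B.regret T ω ∂B.interaction π := by
  rw [integral_regret, ← B.sum_expectedPulls π T, ← Finset.add_sum_erase _ _ (Finset.mem_univ a),
    ← Finset.add_sum_erase _ _ (Finset.mem_univ a), add_sub_cancel_left, Finset.mul_sum]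
  refine (Finset.sum_le_sum fun b hb => ?_).trans (le_add_of_nonneg_left
    (mul_nonneg (B.gap_nonneg a) (B.expectedPulls_nonneg π T a)))
  exact mul_le_mul_of_nonneg_right (h b (Finset.ne_of_mem_erase hb)) (B.expectedPulls_nonneg π T b)

theorem tendsto_expectedPulls_div {alg : InformedAlgorithm K m} (halg : alg.IsConsistent)
    {B : UpliftingBandit K m} (hB : B.IsOneSubGaussian) {a : Fin K} (ha : 0 < B.gap a) :
    Tendsto (fun T : ℕ => B.expectedPulls (alg B.base B.affected) T a / T) atTop (nhds 0) := by
  have h := (halg B hB 1 one_pos).tendsto_div_nhds_zero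
  simp only [Real.rpow_one] at h
  have h2 := h.div_const (B.gap a)
  rw [zero_div] at h2
  refine squeeze_zero (fun T => div_nonneg (B.expectedPulls_nonneg _ T a) T.cast_nonneg)
    (fun T => ?_) h2
  rw [div_right_comm]
  refine div_le_div_of_nonneg_right ?_ T.cast_nonneg
  rw [le_div_iff₀' ha]
  exact B.gap_mul_expectedPulls_le_integral_regret _ T a

/-- Action `a` becomes the only optimal one when the common mean of its affected variables is raised
so that its reward exceeds the optimal one by `δ`; all other gaps are then at least `δ`. -/
theorem le_gap_gaussian_update (V : Fin K → Finset (Fin m)) (c : Fin K → ℝ) {a : Fin K}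
    (hV : (V a).Nonempty) (δ : ℝ) {b : Fin K} (hb : b ≠ a) :
    δ ≤ (gaussian V (Function.update c a
      (((gaussian V c).optReward + δ) / (V a).card))).gap b := by
  have hL : ((V a).card : ℝ) ≠ 0 := by exact_mod_cast hV.card_pos.ne'
  set c' := Function.update c a (((gaussian V c).optReward + δ) / (V a).card)
  have hra : (gaussian V c').reward a = (gaussian V c).optReward + δ := by
    rw [reward_gaussian]; simp only [c', Function.update_self]; field_simp
  have hrb : (gaussian V c').reward b = (gaussian V c).reward b := by
    simp [reward_gaussian, c', hb]
  have h1 := (gaussian V c').reward_le_optReward a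
  have h2 := (gaussian V c).reward_le_optReward b
  unfold gap
  linarith

/-- For a Gaussian instance, a consistent algorithm pays at least `2 L ^ 2 / Δ * log T`
asymptotically for each suboptimal action with gap `Δ` and `L` affected variables. -/
theorem eventually_le_gap_mul_expectedPulls_div_log {alg : InformedAlgorithm K m}
    (halg : alg.IsConsistent) (V : Fin K → Finset (Fin m)) (c : Fin K → ℝ) {a : Fin K}
    (hV : (V a).Nonempty) (ha : 0 < (gaussian V c).gap a) {ε : ℝ} (hε : 0 < ε) :
    ∀ᶠ T : ℕ in atTop, 2 * ((V a).card : ℝ) ^ 2 / (gaussian V c).gap a - ε ≤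
      (gaussian V c).gap a *
        (gaussian V c).expectedPulls (alg (gaussian V c).base V) T a / Real.log T := by
  set B := gaussian V c with hBdef
  set D := B.gap a with hD
  set ℓ : ℝ := ((V a).card : ℝ) with hℓ
  set π := alg B.base V
  have hℓ0 : 0 < ℓ := by rw [hℓ]; exact_mod_cast hV.card_pos
  obtain ⟨i, hi⟩ := hV
  -- `p` serves as the exponent in the consistency assumption and as the margin by which `a` becomes
  -- optimal in the alternative instance
  obtain ⟨p, ⟨hp0, hp1⟩, hp⟩ : ∃ p : ℝ, p ∈ Set.Ioo (0 : ℝ) 1 ∧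
      2 * ℓ ^ 2 / D - ε < D * ((1 - p) / ((D + p) ^ 2 / (2 * ℓ ^ 2))) := by
    have hc : ContinuousAt (fun p : ℝ => D * ((1 - p) / ((D + p) ^ 2 / (2 * ℓ ^ 2)))) 0 := by
      have : (D + 0) ^ 2 / (2 * ℓ ^ 2) ≠ 0 := by rw [add_zero]; positivity
      fun_prop (disch := assumption)
    have h0 : 2 * ℓ ^ 2 / D - ε < D * ((1 - 0) / ((D + 0) ^ 2 / (2 * ℓ ^ 2))) := by
      have : D * ((1 - 0) / ((D + 0) ^ 2 / (2 * ℓ ^ 2))) = 2 * ℓ ^ 2 / D := by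
        field_simp; ring
      linarith
    have h1 := (hc.eventually (lt_mem_nhds h0)).filter_mono (nhdsWithin_le_nhds (s := Set.Ioi 0))
    exact Filter.nonempty_of_mem (Filter.inter_mem (Ioo_mem_nhdsGT one_pos) h1)
  set x' : ℝ := (B.optReward + p) / ℓ with hx'
  set B' := gaussian V (Function.update c a x')
  have hκ : (x' - c a) ^ 2 / 2 = (D + p) ^ 2 / (2 * ℓ ^ 2) := by
    have hr : B.reward a = ℓ * c a := reward_gaussian V c a
    have : x' - c a = (D + p) / ℓ := by
      rw [hx', hD, gap, hr]; field_simp; ring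
    rw [this]; field_simp
  set κ := (D + p) ^ 2 / (2 * ℓ ^ 2)
  have hκ0 : 0 < κ := by positivity
  have hB'gap : ∀ b, b ≠ a → p ≤ B'.gap b := fun b hb =>
    le_gap_gaussian_update V c ⟨i, hi⟩ p hb
  have hlog : Tendsto (fun T : ℕ => Real.log T) atTop atTop :=
    Real.tendsto_log_atTop.comp tendsto_natCast_atTop_atTop
  have hu : Tendsto (fun T : ℕ => B.expectedPulls π T a / T) atTop (nhds 0) :=
    tendsto_expectedPulls_div halg (isOneSubGaussian_gaussian V c) ha
  have hlim : Tendsto (fun T : ℕ => D * (((1 - p) * (1 - B.expectedPulls π T a / T)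
      - Real.log 2 / Real.log T) / κ)) atTop (nhds (D * ((1 - p) / κ))) := by
    have h1 := (((hu.const_sub 1).const_mul (1 - p)).sub
      (hlog.const_div_atTop (Real.log 2))).div_const κ |>.const_mul D
    simpa using h1
  -- the two instances share the baseline and the affected sets, hence are played by the same policy
  have hreg : ∀ T, B'.expectedRegret alg T = ∫ ω, B'.regret T ω ∂B'.interaction π := by
    intro T
    simp only [expectedRegret, π, B, B', affected_gaussian, base_gaussian]
  have hcons := (halg B' (isOneSubGaussian_gaussian V _) p hp0).bound hp0
  filter_upwards [hlim.eventually (lt_mem_nhds hp), hcons, hlog.eventually_gt_atTop 0,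
    eventually_gt_atTop 0] with T hT1 hT2 hT3 hT4
  have hT : (0 : ℝ) < T := by exact_mod_cast hT4
  have hrest : T - B'.expectedPulls π T a ≤ (T : ℝ) ^ p := by
    have h1 := B'.mul_sub_expectedPulls_le_integral_regret π hB'gap T
    have h2 : p * (T - B'.expectedPulls π T a) ≤ p * (T : ℝ) ^ p := by
      refine h1.trans ((le_abs_self _).trans ?_)
      rw [Real.norm_eq_abs, Real.norm_eq_abs, abs_of_nonneg (Real.rpow_nonneg hT.le p), hreg]
        at hT2
      exact hT2
    exact le_of_mul_le_mul_left h2 hp0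
  have hinfo := information_inequality c π hi x' ((1 - p) * Real.log T) hT4
  rw [hκ] at hinfo
  -- `s = (1 - p) * log T` is chosen so that `exp s * (T ^ p / T) = 1`
  have hone : Real.exp ((1 - p) * Real.log T) * (1 - B'.expectedPulls π T a / T) ≤ 1 := by
    have h1 : 1 - B'.expectedPulls π T a / T ≤ (T : ℝ) ^ p / T := by
      rw [one_sub_div hT.ne']; exact div_le_div_of_nonneg_right hrest hT.le
    refine (mul_le_mul_of_nonneg_left h1 (Real.exp_pos _).le).trans_eq ?_
    rw [mul_comm (1 - p), ← Real.rpow_def_of_pos hT, ← mul_div_assoc, ← Real.rpow_add hT]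
    simp [hT.ne']
  have h2 : (1 - p) * Real.log T * (1 - B.expectedPulls π T a / T)
      - κ * B.expectedPulls π T a ≤ Real.log 2 := by
    rw [Real.le_log_iff_exp_le two_pos]
    linarith
  refine hT1.le.trans ?_
  rw [mul_div_assoc]
  refine mul_le_mul_of_nonneg_left ?_ ha.le
  rw [div_le_iff₀ hκ0, sub_le_iff_le_add, div_mul_eq_mul_div, ← add_div, le_div_iff₀ hT3]
  linarith

/-- Asymptotic lower bound on the regret of a consistent algorithm on a Gaussian instance. -/
theorem le_liminf_expectedRegret_gaussian {alg : InformedAlgorithm K m} (halg : alg.IsConsistent)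
    (V : Fin K → Finset (Fin m)) (c : Fin K → ℝ) (hV : ∀ a, (V a).Nonempty) :
    ((∑ a with 0 < (gaussian V c).gap a,
        2 * ((V a).card : ℝ) ^ 2 / (gaussian V c).gap a : ℝ) : EReal) ≤
      liminf (fun T : ℕ => (((gaussian V c).expectedRegret alg T / Real.log T : ℝ) : EReal))
        atTop := by
  set B := gaussian V c
  set S : ℝ := ∑ a with 0 < B.gap a, 2 * ((V a).card : ℝ) ^ 2 / B.gap a with hS
  refine le_of_forall_lt fun x hx => ?_
  obtain ⟨y, hxy, hy⟩ := EReal.lt_iff_exists_real_btwn.1 hx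
  refine hxy.trans_le (le_liminf_of_le (by isBoundedDefault) ?_)
  have hy' : y < S := by exact_mod_cast hy
  let ε : ℝ := (S - y) / (K + 1)
  have hε : 0 < ε := div_pos (sub_pos.2 hy') (by positivity)
  have hall : ∀ᶠ T : ℕ in atTop, ∀ a, 0 < B.gap a → 2 * ((V a).card : ℝ) ^ 2 / B.gap a - ε ≤
      B.gap a * B.expectedPulls (alg B.base V) T a / Real.log T := by
    rw [eventually_all]
    intro a
    by_cases ha : 0 < B.gap a
    · exact (eventually_le_gap_mul_expectedPulls_div_log halg V c (hV a) ha hε).mono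
        fun T hT _ => hT
    · exact Eventually.of_forall fun T h => absurd h ha
  filter_upwards [hall, eventually_gt_atTop 0] with T hT hT0
  have hlog : 0 ≤ Real.log T := Real.log_nonneg (by exact_mod_cast hT0)
  rw [EReal.coe_le_coe_iff]
  have hcard : (#{a | 0 < B.gap a} : ℝ) * ε ≤ S - y := by
    have h1 : (#{a | 0 < B.gap a} : ℝ) ≤ K + 1 := by
      have : #{a | 0 < B.gap a} ≤ K := (Finset.card_filter_le _ _).trans_eq (by simp)
      have : (#{a | 0 < B.gap a} : ℝ) ≤ K := by exact_mod_cast this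
      linarith
    refine (mul_le_mul_of_nonneg_right h1 hε.le).trans_eq ?_
    simp only [ε]; field_simp
  calc y ≤ S - #{a | 0 < B.gap a} * ε := by linarith
    _ = ∑ a with 0 < B.gap a, (2 * ((V a).card : ℝ) ^ 2 / B.gap a - ε) := by
        rw [Finset.sum_sub_distrib, ← hS]; simp
    _ ≤ ∑ a with 0 < B.gap a, B.gap a * B.expectedPulls (alg B.base V) T a / Real.log T :=
        Finset.sum_le_sum fun a ha => hT a (Finset.mem_filter.1 ha).2
    _ ≤ ∑ a, B.gap a * B.expectedPulls (alg B.base V) T a / Real.log T :=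
        Finset.sum_le_sum_of_subset_of_nonneg (Finset.filter_subset _ _) fun a _ _ =>
          div_nonneg (mul_nonneg (B.gap_nonneg a) (B.expectedPulls_nonneg _ T a)) hlog
    _ = B.expectedRegret alg T / Real.log T := by
        rw [← Finset.sum_div, expectedRegret, integral_regret]; rfl

end UpliftingBandit

theorem mainTheorem4 (K m : ℕ) (hK : 0 < K) (hm : 0 < m)
    (alg : InformedAlgorithm K m) (halg : InformedAlgorithm.IsConsistent alg)
    (L : Fin K → ℕ) (Δ : Fin K → ℝ)
    (hL : ∀ a, 1 ≤ L a ∧ L a ≤ m) (hΔ : ∀ a, 0 ≤ Δ a) (hΔ1 : Δ ⟨0, hK⟩ = 0) :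
    ∃ B : UpliftingBandit K m, B.IsOneSubGaussian ∧ B.HasParameters Δ L ∧
      (∀ a, ∀ i ∈ B.affected a, B.mean a i ≠ B.baseMean i) ∧
      ((∑ a with 0 < Δ a, 2 * (L a : ℝ) ^ 2 / Δ a : ℝ) : EReal) ≤
        liminf (fun T : ℕ => ((B.expectedRegret alg T / Real.log T : ℝ) : EReal)) atTop := by
  have hV : ∀ a, ∃ V : Finset (Fin m), V.card = L a := fun a => by
    obtain ⟨V, -, hV⟩ := Finset.exists_subset_card_eq
      (s := (Finset.univ : Finset (Fin m))) (n := L a) (by simpa using (hL a).2)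
    exact ⟨V, hV⟩
  choose V hV using hV
  have hL0 : ∀ a, (0 : ℝ) < L a := fun a => by exact_mod_cast (hL a).1
  -- the optimal reward is `-1`, so that the mean shifts below are all nonzero
  let c : Fin K → ℝ := fun a => -(1 + Δ a) / L a
  let B := UpliftingBandit.gaussian V c
  have hr : ∀ a, B.reward a = -(1 + Δ a) := fun a => by
    have := (hL0 a).ne'
    simp only [B, UpliftingBandit.reward_gaussian, hV, c]
    field_simp
  have hopt : B.optReward = -1 := by
    rw [B.optReward_eq_of_forall_le (a := ⟨0, hK⟩), hr, hΔ1, add_zero]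
    intro b
    rw [hr, hr, hΔ1]
    linarith [hΔ b]
  have hgap : ∀ a, B.gap a = Δ a := fun a => by
    rw [UpliftingBandit.gap, hopt, hr]; ring
  refine ⟨B, UpliftingBandit.isOneSubGaussian_gaussian V c, fun a => ⟨hgap a, hV a⟩,
    fun a i hi => ?_, ?_⟩
  · have hi' : i ∈ V a := hi
    rw [UpliftingBandit.mean_gaussian, UpliftingBandit.baseMean_gaussian, if_pos hi']
    exact div_ne_zero (by linarith [hΔ a]) (hL0 a).ne'
  · have h := UpliftingBandit.le_liminf_expectedRegret_gaussian halg V c fun a =>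
      Finset.card_pos.1 (by rw [hV]; exact (hL a).1)
    simpa only [hgap, hV, B] using h
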